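/- Let $X$ be a directed graph, and for vertices $x,y$ let $d(x,y)\in\mathbb{N}\cup\{\infty\}$ be the length of a shortest directed path from $x$ to $y$ ($\infty$ if there is none). A directed path $[x_0,\dots,x_n]$ is a geodesic if $n=d(x_0,x_n)$. A geodesic triangle is a triple $(p,q,r)$ of geodesics such that $p$ ends where $q$ starts, $r$ starts where $p$ starts, and $r$ ends where $q$ ends. For a real number $\delta\ge 0$ the triangle is $\delta$-thin if each side $s$ has the following property: every vertex $v$ of $s$ satisfies $d(u,v)\le\delta$ for some vertex $u$ of the side meeting $s$ at its start, or $d(v,w)\le\delta$ for some vertex $w$ of the side meeting $s$ at its end. Explicitly, every vertex of $r$ is within $\delta$ from some vertex of $p$ or within $\delta$ to some vertex of $q$; every vertex of $p$ is within $\delta$ from some vertex of $r$ or within $\delta$ to some vertex of $q$; and every vertex of $q$ is within $\delta$ from some vertex of $p$ or within $\delta$ to some vertex of $r$. The directed graph $X$ is strongly $\delta$-hyperbolic if all its geodesic triangles are $\delta$-thin. A monoid $M$ is strongly hyperbolic if, for some finite set $S$ generating $M$ as a monoid and some $\delta\ge 0$, its right Cayley graph with respect to $S$ (vertex set $M$,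 edges $m\to ms$ for $m\in M$, $s\in S$) is strongly $\delta$-hyperbolic. A group $G$ is (word) hyperbolic if, for some finite set $A$ generating $G$ as a group and some $\delta\ge 0$, its undirected Cayley graph with respect to $A$ is $\delta$-hyperbolic in the usual sense: in every geodesic triangle (with vertices of the graph as corners), every vertex on one side is within distance $\delta$ of a vertex on one of the other two sides. **Theorem.** Let $M$ be a (two-sided) cancellative monoid that is strongly hyperbolic. Then the group of units of $M$ is a (word) hyperbolic group. -/

import Mathlib

open scoped NNReal ENNReal

/-! ### Directed graphs and thin triangles -/

namespace Digraph

variable {V : Type*} (X : Digraph V)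

/-- The edge set of a directed graph, as a binary relation. -/
def edgeRel : SetRel V V := {e | X.Adj e.1 e.2}

/-- A path of length `n` in a directed graph: a sequence `[x₀, …, xₙ]` of vertices
such that there is an edge from each `xᵢ` to `xᵢ₊₁`. -/
abbrev Path := RelSeries X.edgeRel

/-- The length of a shortest directed path from `x` to `y`, or `∞` if there is none. -/
noncomputable def edist (x y : V) : ℕ∞ :=
  ⨅ (p : X.Path) (_ : p.head = x ∧ p.last = y), (p.length : ℕ∞)

variable {X}

/-- A path is geodesic if its length is the distance from its start to its end. -/
def Path.IsGeodesic (p : X.Path) : Prop :=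
  (p.length : ℕ∞) = X.edist p.head p.last

variable (X)

/-- The out-ball of radius `δ` based at `x`. -/
def outBall (δ : ℝ≥0) (x : V) : Set V := {y | (X.edist x y : ℝ≥0∞) ≤ δ}

/-- The in-ball of radius `δ` based at `x`. -/
def inBall (δ : ℝ≥0) (x : V) : Set V := {y | (X.edist y x : ℝ≥0∞) ≤ δ}

/-- The union of the out-balls of radius `δ` around the points of `S`. -/
def outNhd (δ : ℝ≥0) (S : Set V) : Set V := ⋃ x ∈ S, X.outBall δ x

/-- The union of the in-balls of radius `δ` around the points of `S`. -/
def inNhd (δ : ℝ≥0) (S : Set V) : Set V := ⋃ x ∈ S, X.inBall δ x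

variable {X}

/-- The set of vertices visited by a path. -/
def Path.support (p : X.Path) : Set V := {x | x ∈ p}

/-- A geodesic triangle: `p`, `q`, `r` are geodesics, `p` and `q` are composable, and
the composite of `p` and `q` is parallel to `r`. -/
structure IsGeodesicTriangle (p q r : X.Path) : Prop where
  geodesic_left : Path.IsGeodesic p
  geodesic_right : Path.IsGeodesic q
  geodesic_base : Path.IsGeodesic r
  composable : p.last = q.head
  start_eq : p.head = r.head
  end_eq : q.last = r.last

/-- A triangle `(p, q, r)` is `δ`-thin if each side is contained in the union of the out-balls of
radius `δ` around points on the side meeting its start, and the in-balls of radius `δ`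
around points on the side meeting its end. -/
def IsThin (δ : ℝ≥0) (p q r : X.Path) : Prop :=
  Path.support r ⊆ X.outNhd δ (Path.support p) ∪ X.inNhd δ (Path.support q) ∧
  Path.support p ⊆ X.outNhd δ (Path.support r) ∪ X.inNhd δ (Path.support q) ∧
  Path.support q ⊆ X.outNhd δ (Path.support p) ∪ X.inNhd δ (Path.support r)

variable (X)

/-- A directed graph is strongly `δ`-hyperbolic if all of its geodesic triangles are `δ`-thin. -/
def StronglyHyperbolic (δ : ℝ≥0) : Prop :=
  ∀ p q r : X.Path, IsGeodesicTriangle p q r → IsThin δ p q r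

/-- The right Cayley graph of a monoid: an edge from `m` to `m * s` for each `s ∈ S`. -/
def rightCayley {M : Type*} [Monoid M] (S : Set M) : Digraph M where
  Adj m n := ∃ s ∈ S, m * s = n

end Digraph

/-- A monoid is strongly hyperbolic if, for some finite monoid generating set `S` and some `δ`,
its right Cayley graph with respect to `S` is strongly `δ`-hyperbolic. -/
def IsStronglyHyperbolicMonoid (M : Type*) [Monoid M] : Prop :=
  ∃ S : Set M, S.Finite ∧ Submonoid.closure S = ⊤ ∧
    ∃ δ : ℝ≥0, (Digraph.rightCayley S).StronglyHyperbolic δ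

/-! ### Hyperbolic groups in the classical sense -/

/-- An undirected graph is `δ`-hyperbolic if its geodesic triangles are `δ`-slim: for all geodesics
`p`, `q`, `r` joining the three pairs of vertices from `x`, `y`, `z`, every vertex of `p` is within
distance `δ` of a vertex of `q` or of `r`. (As the names of the corners are arbitrary, this says
the same of every side of every geodesic triangle.) -/
def SimpleGraph.IsSlimHyperbolic {V : Type*} (G : SimpleGraph V) (δ : ℝ≥0) : Prop :=
  ∀ (x y z : V) (p : G.Walk x y) (q : G.Walk y z) (r : G.Walk x z),
    p.length = G.dist x y → q.length = G.dist y z → r.length = G.dist x z →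
      ∀ u ∈ p.support, ∃ v, (v ∈ q.support ∨ v ∈ r.support) ∧ (G.dist u v : ℝ) ≤ δ

/-- A group is (word) hyperbolic if it has a finite generating set `A` such that its undirected
Cayley graph with respect to `A` is `δ`-hyperbolic for some `δ`. -/
def IsHyperbolicGroup (G : Type*) [Group G] : Prop :=
  ∃ A : Set G, A.Finite ∧ Subgroup.closure A = ⊤ ∧
    ∃ δ : ℝ≥0, (SimpleGraph.mulCayley A).IsSlimHyperbolic δ

/-! In a cancellative monoid every factor of a unit is a unit. Hence directed geodesics between
units run through units, and the units in `S` generate `Mˣ`. So `Mˣ` carries the word metric `e` of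
these generators and the directed distance `d`, with `e ≤ d ≤ K * e` because the finitely many
inverse generators have bounded directed length. Units are joined by directed geodesics in both
directions, so directed triangles exist, and are thin, for every ordering of the corners
(`IsThinPair`).

It remains to pass from `d`-geodesics to `e`-geodesics, as in the stability of quasi-geodesics.
Bisection bounds the distance from a `d`-geodesic to an `e`-path logarithmically in the length of
the path (`exists_dist_le_log`). Applied around a point of the `d`-geodesic at maximal distance `D`
from an `e`-geodesic, this bounds `D` by a multiple of `log D` plus a constant, hence uniformly
(`exists_dist_le_geodesic`). Closeness in the other direction is a discrete connectedness argument
(`exists_dist_le_of_close`), and together they transfer slimness (`slim`). -/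

/-! ### Stability of directed geodesics -/

/-- The first `n + 1` terms of `f` form a geodesic for the (possibly asymmetric) distance `d`. -/
def IsGeodesicSeq {V : Type*} (d : V → V → ℕ) (f : ℕ → V) (n : ℕ) : Prop :=
  ∀ i j, i ≤ j → j ≤ n → d (f i) (f j) = j - i

theorem IsGeodesicSeq.shift {V : Type*} {d : V → V → ℕ} {f : ℕ → V} {n : ℕ}
    (hf : IsGeodesicSeq d f n) {a m : ℕ} (h : a + m ≤ n) :
    IsGeodesicSeq d (fun t => f (a + t)) m := by
  intro i j hij hj
  have := hf (a + i) (a + j) (by lia) (by lia)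
  simp only [this]
  lia

/-- A symmetric distance `e` and a directed geodesic distance `d`, comparable up to the factor `K`,
such that the base of every geodesic triangle for `d` is `h`-close to the other two sides. -/
structure IsThinPair {V : Type*} (e d : V → V → ℕ) (K h : ℕ) : Prop where
  self (x : V) : e x x = 0
  comm (x y : V) : e x y = e y x
  triangle (x y z : V) : e x z ≤ e x y + e y z
  le (x y : V) : e x y ≤ d x y
  le_mul (x y : V) : d x y ≤ K * e x y
  exists_geodesic (x y : V) : ∃ f, IsGeodesicSeq d f (d x y) ∧ f 0 = x ∧ f (d x y) = y
  thin (f g k : ℕ → V) (n m l : ℕ) (hf : IsGeodesicSeq d f n) (hg : IsGeodesicSeq d g m)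
    (hk : IsGeodesicSeq d k l) (hfg : f n = g 0) (hfk : f 0 = k 0) (hgk : g m = k l) :
    ∀ i ≤ l, (∃ j ≤ n, e (k i) (f j) ≤ h) ∨ (∃ j ≤ m, e (k i) (g j) ≤ h)

namespace IsThinPair

variable {V : Type*} {e d : V → V → ℕ} {K h : ℕ}

/-- Bisect the chain `c`: each of the `k` halvings costs `h`, and a chain of at most one edge spans
a directed geodesic of length at most `K`. -/
theorem exists_dist_le_log (H : IsThinPair e d K h) (k : ℕ) :
    ∀ (c f : ℕ → V) (m n : ℕ), m ≤ 2 ^ k → (∀ t < m, e (c t) (c (t + 1)) ≤ 1) →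
      IsGeodesicSeq d f n → f 0 = c 0 → f n = c m →
      ∀ i ≤ n, ∃ t ≤ m, e (f i) (c t) ≤ h * k + K := by
  induction k with
  | zero =>
    intro c f m n hm hc hf h0 hn i hi
    refine ⟨0, by lia, ?_⟩
    have h1 : e (f 0) (f n) ≤ 1 := by
      rw [h0, hn]
      obtain rfl | rfl : m = 0 ∨ m = 1 := by simp at hm; lia
      · simp [H.self]
      · exact hc 0 (by lia)
    have h2 := hf 0 n (by lia) le_rfl
    have h3 := H.le_mul (f 0) (f n)
    have h4 := hf 0 i (by lia) hi
    have h5 := H.le (f 0) (f i)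
    have h6 : K * e (f 0) (f n) ≤ K * 1 := Nat.mul_le_mul_left _ h1
    rw [← h0, H.comm]
    lia
  | succ k ih =>
    intro c f m n hm hc hf h0 hn i hi
    obtain ⟨a, b, rfl, ha, hb⟩ : ∃ a b, m = a + b ∧ a ≤ 2 ^ k ∧ b ≤ 2 ^ k :=
      ⟨min m (2 ^ k), m - 2 ^ k, by lia, by lia, by rw [pow_succ] at hm; lia⟩
    obtain ⟨p, hp, hp0, hp1⟩ := H.exists_geodesic (c 0) (c a)
    obtain ⟨q, hq, hq0, hq1⟩ := H.exists_geodesic (c a) (c (a + b))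
    rcases H.thin p q f _ _ n hp hq hf (by rw [hp1, hq0]) (by rw [hp0, h0]) (by rw [hq1, hn]) i hi
      with ⟨j, hj, hj'⟩ | ⟨j, hj, hj'⟩
    · obtain ⟨t, ht, ht'⟩ := ih c p a _ ha (fun t ht => hc t (by lia)) hp hp0 hp1 j hj
      refine ⟨t, by lia, (H.triangle _ (p j) _).trans ?_⟩
      rw [mul_add]
      lia
    · obtain ⟨t, ht, ht'⟩ := ih (fun t => c (a + t)) q b _ hb
        (fun t ht => hc (a + t) (by lia)) hq hq0 hq1 j hj
      refine ⟨a + t, by lia, (H.triangle _ (q j) _).trans ?_⟩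
      rw [mul_add]
      lia

/-- Nothing orders `a` and `b`; since `e` is symmetric, `g` run backwards is a chain too. -/
theorem exists_dist_le_log_of_geodesic (H : IsThinPair e d K h) (k : ℕ) {g f : ℕ → V} {m n a b : ℕ}
    (hg : IsGeodesicSeq e g m) (ha : a ≤ m) (hb : b ≤ m) (hab : e (g a) (g b) ≤ 2 ^ k)
    (hf : IsGeodesicSeq d f n) (h0 : f 0 = g a) (hn : f n = g b) {i : ℕ} (hi : i ≤ n) :
    ∃ t ≤ m, e (f i) (g t) ≤ h * k + K := by
  rcases le_total a b with hle | hle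
  · obtain ⟨t, ht, h'⟩ := H.exists_dist_le_log k (fun t => g (a + t)) f (b - a) n
      (by rw [hg a b hle hb] at hab; exact hab)
      (fun t ht => by have := hg (a + t) (a + (t + 1)) (by lia) (by lia); simp only [this]; lia)
      hf h0 (by simpa [Nat.add_sub_cancel' hle] using hn) i hi
    exact ⟨a + t, by lia, h'⟩
  · obtain ⟨t, ht, h'⟩ := H.exists_dist_le_log k (fun t => g (a - t)) f (a - b) n
      (by rw [H.comm, hg b a hle ha] at hab; exact hab)
      (fun t ht => by
        have := hg (a - (t + 1)) (a - t) (by lia) (by lia)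
        simp only [H.comm (g (a - t)), this]; lia)
      hf h0 (by simpa [Nat.sub_sub_self hle] using hn) i hi
    exact ⟨a - t, by lia, h'⟩

/-- A diagonal from `f 0` to `g b` cuts the quadrilateral into two thin triangles, so `f i` is
within `2 * h` of one of the other three sides. `hl` and `hr` exclude the two sides joining `f` to
`g`; on the remaining one the logarithmic bound applies. -/
theorem exists_dist_le_quadrilateral (H : IsThinPair e d K h) {f g : ℕ → V} {m n a b : ℕ}
    (hg : IsGeodesicSeq e g m) (ha : a ≤ m) (hb : b ≤ m)
    (hf : IsGeodesicSeq d f n) {i k D : ℕ} (hi : i ≤ n) (hab : e (g a) (g b) ≤ 2 ^ k)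
    (hD : 2 * h < D) (hl : d (f 0) (g a) + D ≤ e (f 0) (f i))
    (hr : d (g b) (f n) + D ≤ e (f i) (f n)) :
    ∃ t ≤ m, e (f i) (g t) ≤ 2 * h + (h * k + K) := by
  obtain ⟨p, hp, hp0, hp1⟩ := H.exists_geodesic (f 0) (g a)
  obtain ⟨q, hq, hq0, hq1⟩ := H.exists_geodesic (g a) (g b)
  obtain ⟨r, hr', hr0, hr1⟩ := H.exists_geodesic (g b) (f n)
  obtain ⟨s, hs, hs0, hs1⟩ := H.exists_geodesic (f 0) (g b)
  rcases H.thin s r f _ _ n hs hr' hf (by rw [hs1, hr0]) hs0 hr1 i hi with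
    ⟨j, hj, hij⟩ | ⟨j, hj, hij⟩
  · rcases H.thin p q s _ _ _ hp hq hs (by rw [hp1, hq0]) (by rw [hp0, hs0]) (by rw [hq1, hs1])
      j hj with ⟨l, hl', hjl⟩ | ⟨l, hl', hjl⟩
    · have h1 := H.triangle (f 0) (p l) (f i)
      have h2 := H.triangle (f i) (s j) (p l)
      have h3 := H.le (f 0) (p l)
      have h4 := hp 0 l (by lia) hl'
      rw [hp0] at h4
      rw [H.comm (p l)] at h1
      lia
    · obtain ⟨t, ht, ht'⟩ := H.exists_dist_le_log_of_geodesic k hg ha hb hab hq hq0 hq1 hl'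
      have h1 := H.triangle (f i) (s j) (q l)
      have h2 := H.triangle (f i) (q l) (g t)
      exact ⟨t, ht, by lia⟩
  · have h1 := H.triangle (f i) (r j) (f n)
    have h3 := H.le (r j) (f n)
    have h4 := hr' j _ hj le_rfl
    rw [hr1] at h4
    lia

theorem exists_linear_le_two_pow (C q : ℕ) : ∃ R, ∀ D ≥ R, C * D ≤ 2 ^ (D / (q + 1)) := by
  have h1 := (tendsto_pow_const_div_const_pow_of_one_lt 1 (one_lt_two (α := ℝ))).const_mul
    ((C * (2 * (q + 1)) : ℕ) : ℝ)
  rw [mul_zero] at h1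
  obtain ⟨N, hN⟩ := Filter.eventually_atTop.1 (h1.eventually (gt_mem_nhds one_pos))
  refine ⟨(N + 1) * (q + 1), fun D hD => ?_⟩
  have hq : N + 1 ≤ D / (q + 1) := (Nat.le_div_iff_mul_le (by lia)).2 hD
  have h2 := hN (D / (q + 1)) (by lia)
  rw [pow_one, ← mul_div_assoc, div_lt_one (by positivity)] at h2
  have h3 : C * (2 * (q + 1)) * (D / (q + 1)) < 2 ^ (D / (q + 1)) := by exact_mod_cast h2
  have h4 : D ≤ 2 * ((q + 1) * (D / (q + 1))) := by
    have := Nat.div_add_mod D (q + 1)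
    have := Nat.mod_lt D (Nat.succ_pos q)
    have := Nat.mul_le_mul_left (q + 1) (show 1 ≤ D / (q + 1) by lia)
    lia
  calc C * D ≤ C * (2 * ((q + 1) * (D / (q + 1)))) := Nat.mul_le_mul_left _ h4
    _ = C * (2 * (q + 1)) * (D / (q + 1)) := by ring
    _ ≤ _ := h3.le

/-- A directed geodesic stays uniformly close to any undirected geodesic with the same ends. -/
theorem exists_dist_le_geodesic (H : IsThinPair e d K h) (hK : 0 < K) :
    ∃ R, ∀ (f g : ℕ → V) (n m : ℕ), IsGeodesicSeq d f n → IsGeodesicSeq e g m →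
      f 0 = g 0 → f n = g m → ∀ i ≤ n, ∃ t ≤ m, e (f i) (g t) ≤ R := by
  obtain ⟨R, hR⟩ := exists_linear_le_two_pow (2 * (K * (K + 1)) + 2) (2 * h)
  -- Beyond this value `hR` applies and `D ≤ 2 * h + D / 2 + K` is impossible.
  refine ⟨R + 4 * h + 2 * K + 1, fun f g n m hf hg h0 hn => ?_⟩
  have hex : ∃ D, ∀ i ≤ n, ∃ t ≤ m, e (f i) (g t) ≤ D := by
    refine ⟨n, fun i hi => ⟨0, by lia, ?_⟩⟩
    have h1 := hf 0 i (by lia) hi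
    have h2 := H.le (f 0) (f i)
    rw [← h0, H.comm]
    lia
  classical
  obtain ⟨D, hD, hmin⟩ : ∃ D, (∀ i ≤ n, ∃ t ≤ m, e (f i) (g t) ≤ D) ∧
      ∀ D' < D, ¬ ∀ i ≤ n, ∃ t ≤ m, e (f i) (g t) ≤ D' :=
    ⟨Nat.find hex, Nat.find_spec hex, fun D' hD' => Nat.find_min hex hD'⟩
  suffices D ≤ R + 4 * h + 2 * K + 1 from fun i hi =>
    (hD i hi).imp fun t ht => ⟨ht.1, ht.2.trans this⟩
  by_contra! hlt
  obtain ⟨i, hi, hfar⟩ : ∃ i ≤ n, ∀ t ≤ m, D ≤ e (f i) (g t) := by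
    have := hmin (D - 1) (by lia)
    push Not at this
    obtain ⟨i, hi, h'⟩ := this
    exact ⟨i, hi, fun t ht => by have := h' t ht; lia⟩
  -- Moving `N` along `f` gives `e`-distance at least `(K + 1) * D`: `K * D` pays for the directed
  -- path between `f` and `g`, and `D` is left over.
  obtain ⟨N, hN⟩ : ∃ N, N = K * ((K + 1) * D) := ⟨_, rfl⟩
  -- Points on `f` at bounded distance before and after `f i`, with a nearby point of `g`.
  obtain ⟨y, hy, hyN, a, ha, hya, hay⟩ : ∃ y ≤ i, i ≤ y + N ∧ ∃ a ≤ m, e (f y) (g a) ≤ D ∧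
      d (f y) (g a) + D ≤ e (f y) (f i) := by
    rcases le_total N i with hle | hle
    · obtain ⟨a, ha, h1⟩ := hD (i - N) (by lia)
      refine ⟨i - N, by lia, by lia, a, ha, h1, ?_⟩
      have h2 := H.le_mul (f (i - N)) (f i)
      rw [hf _ _ (by lia) hi, Nat.sub_sub_self hle, hN] at h2
      have h3 := Nat.le_of_mul_le_mul_left h2 hK
      have h4 := (H.le_mul (f (i - N)) (g a)).trans (Nat.mul_le_mul_left _ h1)
      lia
    -- Near the start of `f` the common endpoint serves: the connecting path is trivial and `hfar`
    -- supplies the gap `D`.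
    · refine ⟨0, by lia, by lia, 0, by lia, by simp [h0, H.self], ?_⟩
      have h1 := hf 0 0 le_rfl (by lia)
      have h2 := hfar 0 (by lia)
      rw [← h0] at h2 ⊢
      rw [h1, H.comm]
      lia
  obtain ⟨z, hz, hzn, hzN, b, hb, hzb, hbz⟩ : ∃ z, i ≤ z ∧ z ≤ n ∧ z ≤ i + N ∧ ∃ b ≤ m,
      e (f z) (g b) ≤ D ∧ d (g b) (f z) + D ≤ e (f i) (f z) := by
    rcases le_total (i + N) n with hle | hle
    · obtain ⟨b, hb, h1⟩ := hD (i + N) hle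
      refine ⟨i + N, by lia, hle, le_rfl, b, hb, h1, ?_⟩
      have h2 := H.le_mul (f i) (f (i + N))
      rw [hf _ _ (by lia) hle, Nat.add_sub_cancel_left, hN] at h2
      have h3 := Nat.le_of_mul_le_mul_left h2 hK
      rw [H.comm] at h1
      have h4 := (H.le_mul (g b) (f (i + N))).trans (Nat.mul_le_mul_left _ h1)
      lia
    · refine ⟨n, hi, le_rfl, hle, m, le_rfl, by simp [hn, H.self], ?_⟩
      have h1 := hf n n le_rfl le_rfl
      have h2 := hfar m le_rfl
      rw [← hn] at h2 ⊢
      rw [h1]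
      lia
  have hab : e (g a) (g b) ≤ (2 * (K * (K + 1)) + 2) * D := by
    have h1 := H.triangle (g a) (f y) (g b)
    have h2 := H.triangle (f y) (f z) (g b)
    have h3 := H.le (f y) (f z)
    have h4 := hf y z (by lia) hzn
    rw [H.comm (g a) (f y)] at h1
    have h5 : (2 * (K * (K + 1)) + 2) * D = 2 * N + 2 * D := by rw [hN]; ring
    lia
  have hyi : y + (i - y) = i := by lia
  have hyz : y + (z - y) = z := by lia
  obtain ⟨t, ht, hclose⟩ := H.exists_dist_le_quadrilateral (f := fun t => f (y + t)) (n := z - y)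
    (i := i - y) (D := D) hg ha hb (hf.shift (by lia)) (by lia) (hab.trans (hR D (by lia)))
    (by lia) (by simpa [hyi] using hay) (by simpa [hyi, hyz] using hbz)
  simp only [hyi] at hclose
  have h1 := hfar t ht
  have h2 := Nat.mul_div_le D (2 * h + 1)
  -- The exponent `D / (2 * h + 1)` keeps the logarithmic term at most `D / 2`.
  have h3 : 2 * (h * (D / (2 * h + 1))) ≤ (2 * h + 1) * (D / (2 * h + 1)) := by
    rw [← mul_assoc]; exact Nat.mul_le_mul_right _ (by lia)
  lia

/-- An undirected geodesic stays close to a directed geodesic that stays close to it. -/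
theorem exists_dist_le_of_close (H : IsThinPair e d K h) {f g : ℕ → V} {n m D : ℕ}
    (hf : IsGeodesicSeq d f n) (hg : IsGeodesicSeq e g m) (h0 : f 0 = g 0) (hn : f n = g m)
    (hD : ∀ i ≤ n, ∃ t ≤ m, e (f i) (g t) ≤ D) {s : ℕ} (hs : s ≤ m) :
    ∃ i ≤ n, e (g s) (f i) ≤ 3 * D + 1 := by
  classical
  by_cases hlast : ∃ a ≤ s, e (f n) (g a) ≤ D
  · obtain ⟨a, ha, h1⟩ := hlast
    refine ⟨n, le_rfl, ?_⟩
    rw [hn, H.comm] at h1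
    have h2 := hg a m (by lia) le_rfl
    have h3 := hg s m hs le_rfl
    rw [hn]
    lia
  -- At the first `i + 1` with no close point on `g` up to `s`, `f i` is close to some `g a` with `a
  -- ≤ s` and `f (i + 1)` to some `g b` with `s < b`; then `b - a ≤ 2 * D + 1`.
  · have hex : ∃ i, ¬ ∃ a ≤ s, e (f i) (g a) ≤ D := ⟨n, hlast⟩
    obtain ⟨i, hi⟩ : ∃ i, Nat.find hex = i + 1 := by
      refine Nat.exists_eq_succ_of_ne_zero fun h' => ?_
      have := Nat.find_spec hex
      rw [h'] at this
      exact this ⟨0, by lia, by simp [h0, H.self]⟩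
    have hin : i + 1 ≤ n := hi ▸ Nat.find_min' hex hlast
    obtain ⟨a, ha, h1⟩ := not_not.1 (Nat.find_min hex (show i < Nat.find hex by lia))
    have hspec := Nat.find_spec hex
    rw [hi] at hspec
    push Not at hspec
    obtain ⟨b, hb, h2⟩ := hD (i + 1) hin
    have hsb : s < b := by
      by_contra! h'
      have := hspec b h'
      lia
    have h3 := hg a b (by lia) hb
    have h4 := hg a s ha hs
    have h5 := hf i (i + 1) (by lia) hin
    have h6 := H.le (f i) (f (i + 1))
    have h7 := H.triangle (g a) (f i) (g b)
    have h8 := H.triangle (f i) (f (i + 1)) (g b)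
    have h9 := H.triangle (g s) (g a) (f i)
    rw [H.comm (f i) (g a)] at h1
    rw [H.comm (g s) (g a)] at h9
    exact ⟨i, by lia, by lia⟩

/-- Undirected geodesic triangles are uniformly slim. -/
theorem slim (H : IsThinPair e d K h) (hK : 0 < K) :
    ∃ R, ∀ (p q r : ℕ → V) (n m l : ℕ), IsGeodesicSeq e p n → IsGeodesicSeq e q m →
      IsGeodesicSeq e r l → p 0 = r 0 → p n = q m → q 0 = r l →
      ∀ i ≤ n, (∃ j ≤ m, e (p i) (q j) ≤ R) ∨ (∃ j ≤ l, e (p i) (r j) ≤ R) := by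
  obtain ⟨D, hD⟩ := H.exists_dist_le_geodesic hK
  refine ⟨3 * D + 1 + h + D, fun p q r n m l hp hq hr hpr hpq hqr i hi => ?_⟩
  obtain ⟨p', hp', hp0, hp1⟩ := H.exists_geodesic (p 0) (p n)
  obtain ⟨q', hq', hq0, hq1⟩ := H.exists_geodesic (q 0) (q m)
  obtain ⟨r', hr', hr0, hr1⟩ := H.exists_geodesic (r 0) (r l)
  obtain ⟨j, hj, h1⟩ := H.exists_dist_le_of_close hp' hp hp0 hp1 (hD _ _ _ _ hp' hp hp0 hp1) hi
  have h2 := H.triangle (p i) (p' j)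
  -- Only the base is known to be close to the other sides, so `p'` must be the base.
  rcases H.thin r' q' p' _ _ _ hr' hq' hp' (by rw [hr1, hq0, hqr]) (by rw [hr0, hp0, hpr])
    (by rw [hq1, hp1, hpq]) j hj with ⟨k, hk, h3⟩ | ⟨k, hk, h3⟩
  · obtain ⟨t, ht, h4⟩ := hD _ _ _ _ hr' hr hr0 hr1 k hk
    have h5 := H.triangle (p' j) (r' k) (r t)
    exact .inr ⟨t, ht, (h2 _).trans (by lia)⟩
  · obtain ⟨t, ht, h4⟩ := hD _ _ _ _ hq' hq hq0 hq1 k hk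
    have h5 := H.triangle (p' j) (q' k) (q t)
    exact .inl ⟨t, ht, (h2 _).trans (by lia)⟩

end IsThinPair

/-! ### Directed distance and Cayley graphs -/

namespace Digraph

variable {V : Type*} (X : Digraph V)

variable {X} in
theorem edist_le_length (p : X.Path) : X.edist p.head p.last ≤ p.length :=
  iInf₂_le p ⟨rfl, rfl⟩

theorem exists_path_length_eq_edist {x y : V} (hxy : X.edist x y ≠ ⊤) :
    ∃ p : X.Path, p.head = x ∧ p.last = y ∧ (p.length : ℕ∞) = X.edist x y := by
  have h : X.edist x y < X.edist x y + 1 := ENat.lt_add_one_iff hxy |>.2 le_rfl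
  conv_lhs at h => rw [edist]
  simp only [iInf_lt_iff] at h
  obtain ⟨p, ⟨rfl, rfl⟩, hp⟩ := h
  exact ⟨p, rfl, rfl, le_antisymm ((ENat.lt_add_one_iff hxy).1 hp) (edist_le_length p)⟩

@[simp]
theorem edist_self (x : V) : X.edist x x = 0 :=
  le_antisymm (edist_le_length (RelSeries.singleton X.edgeRel x)) (zero_le)

theorem edist_triangle (x y z : V) : X.edist x z ≤ X.edist x y + X.edist y z := by
  by_cases hxy : X.edist x y = ⊤
  · simp [hxy]
  by_cases hyz : X.edist y z = ⊤
  · simp [hyz]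
  obtain ⟨p, rfl, rfl, hp⟩ := X.exists_path_length_eq_edist hxy
  obtain ⟨q, hpq, rfl, hq⟩ := X.exists_path_length_eq_edist hyz
  have := edist_le_length (p.smash q hpq.symm)
  rw [RelSeries.head_smash, RelSeries.last_smash] at this
  rw [← hp, ← hq]
  exact_mod_cast this

variable {X}

theorem edist_le_one {x y : V} (h : X.Adj x y) : X.edist x y ≤ 1 := by
  let p : X.Path := ⟨1, ![x, y], fun i => by obtain rfl := Subsingleton.elim i 0; exact h⟩
  exact (edist_le_length p).trans_eq Nat.cast_one

theorem adj_of_edist_eq_one {x y : V} (h : X.edist x y = 1) : X.Adj x y := by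
  obtain ⟨p, rfl, rfl, hp⟩ := X.exists_path_length_eq_edist (x := x) (y := y) (by simp [h])
  rw [h] at hp
  obtain ⟨n, f, hf⟩ := p
  obtain rfl : n = 1 := by exact_mod_cast hp
  exact hf 0

/-- The vertex number `i` of a path, or its last vertex if there is none. -/
def Path.vertex (p : X.Path) (i : ℕ) : V := p ⟨min i p.length, by lia⟩

theorem Path.vertex_zero (p : X.Path) : Path.vertex p 0 = p.head := by
  simp [Path.vertex, RelSeries.head]

theorem Path.vertex_length (p : X.Path) : Path.vertex p p.length = p.last := by
  simp [Path.vertex, RelSeries.last, Fin.last]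

theorem Path.adj_vertex (p : X.Path) {i : ℕ} (h : i < p.length) :
    X.Adj (Path.vertex p i) (Path.vertex p (i + 1)) := by
  have h1 : Path.vertex p i = p (Fin.castSucc ⟨i, h⟩) :=
    congrArg p.toFun (Fin.ext (min_eq_left h.le))
  have h2 : Path.vertex p (i + 1) = p (Fin.succ ⟨i, h⟩) :=
    congrArg p.toFun (Fin.ext (min_eq_left h))
  rw [h1, h2]
  exact p.step ⟨i, h⟩

theorem Path.edist_vertex_le (p : X.Path) (i k : ℕ) (h : i + k ≤ p.length) :
    X.edist (Path.vertex p i) (Path.vertex p (i + k)) ≤ k := by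
  induction k with
  | zero => simp
  | succ k ih =>
    refine (X.edist_triangle _ (Path.vertex p (i + k)) _).trans ?_
    push_cast
    refine add_le_add (ih (by lia)) (edist_le_one (Path.adj_vertex p (by lia)))

/-- The edge counts of the three pieces bound their distances from above and add up to the distance
of the ends, so each bound is attained. -/
theorem Path.IsGeodesic.edist_vertex {p : X.Path} (hp : Path.IsGeodesic p) {i j : ℕ} (hij : i ≤ j)
    (hj : j ≤ p.length) : X.edist (Path.vertex p i) (Path.vertex p j) = (j - i : ℕ) := by
  have h1 := Path.edist_vertex_le p 0 i (by lia)
  have h2 := Path.edist_vertex_le p i (j - i) (by lia)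
  have h3 := Path.edist_vertex_le p j (p.length - j) (by lia)
  have h4 := X.edist_triangle (Path.vertex p 0) (Path.vertex p i) (Path.vertex p p.length)
  have h5 := X.edist_triangle (Path.vertex p i) (Path.vertex p j) (Path.vertex p p.length)
  have h6 : _ = _ := hp
  rw [← Path.vertex_zero, ← Path.vertex_length] at h6
  rw [← h6] at h4
  rw [Nat.add_sub_cancel' hij] at h2
  rw [Nat.add_sub_cancel' hj] at h3
  rw [zero_add] at h1
  lift X.edist (Path.vertex p 0) (Path.vertex p i) to ℕ using ne_top_of_le_ne_top (by simp) h1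
    with a
  lift X.edist (Path.vertex p i) (Path.vertex p j) to ℕ using ne_top_of_le_ne_top (by simp) h2
    with b
  lift X.edist (Path.vertex p j) (Path.vertex p p.length) to ℕ
    using ne_top_of_le_ne_top (by simp) h3 with c
  lift X.edist (Path.vertex p i) (Path.vertex p p.length) to ℕ
    using ne_top_of_le_ne_top (by simp) h5 with u
  norm_cast at *
  lia

/-- A sequence of vertices at the right distances is a geodesic. -/
theorem exists_path_of_edist_eq (f : ℕ → V) (n : ℕ)
    (hf : ∀ i j, i ≤ j → j ≤ n → X.edist (f i) (f j) = (j - i : ℕ)) :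
    ∃ p : X.Path, Path.IsGeodesic p ∧ p.head = f 0 ∧ p.last = f n ∧
      Path.support p = f '' Set.Iic n := by
  let p : X.Path := ⟨n, fun i => f i, fun i => adj_of_edist_eq_one (by
    have := hf i (i + 1) (by lia) (by lia)
    simpa using this)⟩
  have h0 : p.head = f 0 := rfl
  have hn : p.last = f n := rfl
  refine ⟨p, ?_, h0, hn, ?_⟩
  · rw [Path.IsGeodesic, h0, hn, hf 0 n (by lia) le_rfl, Nat.sub_zero]
  · ext x
    constructor
    · rintro ⟨i, rfl⟩
      exact ⟨i, Nat.lt_succ_iff.1 i.2, rfl⟩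
    · rintro ⟨i, hi, rfl⟩
      exact ⟨⟨i, Nat.lt_succ_of_le hi⟩, rfl⟩

section Cayley

variable {M : Type*} [Monoid M] {S : Set M}

theorem rightCayley_edist_mul_le (g x y : M) :
    (rightCayley S).edist (g * x) (g * y) ≤ (rightCayley S).edist x y := by
  by_cases hxy : (rightCayley S).edist x y = ⊤
  · simp [hxy]
  obtain ⟨p, rfl, rfl, hp⟩ := exists_path_length_eq_edist _ hxy
  rw [← hp]
  exact edist_le_length (X := rightCayley S) (p.map ⟨(g * ·), by
    rintro a b ⟨s, hs, h⟩
    exact ⟨s, hs, by dsimp only at h ⊢; rw [mul_assoc, h]⟩⟩)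

theorem rightCayley_edist_ne_top (hS : Submonoid.closure S = ⊤) (x m : M) :
    (rightCayley S).edist x (x * m) ≠ ⊤ := by
  have hm : m ∈ Submonoid.closure S := hS ▸ Submonoid.mem_top m
  induction hm using Submonoid.closure_induction generalizing x with
  | mem s hs =>
    exact ne_top_of_le_ne_top (by simp) (edist_le_one (X := rightCayley S) ⟨s, hs, rfl⟩)
  | one => simp
  | mul a b _ _ ha hb =>
    refine ne_top_of_le_ne_top ?_ (edist_triangle _ x (x * a) (x * (a * b)))
    rw [← mul_assoc]
    exact WithTop.add_ne_top.2 ⟨ha x, hb (x * a)⟩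

theorem exists_mul_eq_of_edist_ne_top {x y : M} (h : (rightCayley S).edist x y ≠ ⊤) :
    ∃ m, x * m = y := by
  obtain ⟨p, rfl, rfl, hp⟩ := exists_path_length_eq_edist _ h
  have : ∀ i : ℕ, i ≤ p.length → ∃ m, p.head * m = Path.vertex p i := by
    intro i
    induction i with
    | zero => exact fun _ => ⟨1, by rw [mul_one, Path.vertex_zero]⟩
    | succ i ih =>
      intro hi
      obtain ⟨m, hm⟩ := ih (by lia)
      obtain ⟨s, hs, h⟩ := Path.adj_vertex p hi
      exact ⟨m * s, by rw [← mul_assoc, hm, h]⟩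
  simpa only [Path.vertex_length] using this p.length le_rfl

end Cayley

end Digraph

/-! ### Geodesic walks and slim triangles in undirected graphs -/

namespace SimpleGraph

variable {V : Type*} {G : SimpleGraph V}

theorem exists_walk_length_le (f : ℕ → V) (n : ℕ)
    (hf : ∀ i < n, f i = f (i + 1) ∨ G.Adj (f i) (f (i + 1))) :
    ∃ w : G.Walk (f 0) (f n), w.length ≤ n := by
  induction n with
  | zero => exact ⟨.nil, le_rfl⟩
  | succ n ih =>
    obtain ⟨w, hw⟩ := ih fun i hi => hf i (by lia)
    rcases hf n (by lia) with h | h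
    · exact ⟨w.copy rfl h, by simp; lia⟩
    · exact ⟨w.concat h, by simpa using hw⟩

theorem Walk.isGeodesicSeq_getVert (hG : G.Connected) {x y : V} (p : G.Walk x y)
    (hp : p.length = G.dist x y) : IsGeodesicSeq G.dist p.getVert p.length := by
  have key : ∀ i k, i + k ≤ p.length → G.dist (p.getVert i) (p.getVert (i + k)) ≤ k := by
    intro i k h
    obtain ⟨w, hw⟩ := exists_walk_length_le (G := G) (fun t => p.getVert (i + t)) k
      fun t ht => .inr (p.adj_getVert_succ (by lia))
    exact (dist_le w).trans hw
  intro i j hij hj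
  have h1 := key 0 i (by lia)
  have h2 := key i (j - i) (by lia)
  have h3 := key j (p.length - j) (by lia)
  rw [Nat.add_sub_cancel' hij] at h2
  rw [Nat.add_sub_cancel' hj, Walk.getVert_length] at h3
  rw [zero_add, Walk.getVert_zero] at h1
  have h4 := hG.dist_triangle (u := x) (v := p.getVert i) (w := y)
  have h5 := hG.dist_triangle (u := p.getVert i) (v := p.getVert j) (w := y)
  lia

theorem isSlimHyperbolic_of_isThinPair (hG : G.Connected) {d : V → V → ℕ} {K h : ℕ} (hK : 0 < K)
    (H : IsThinPair G.dist d K h) : ∃ δ : ℝ≥0, G.IsSlimHyperbolic δ := by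
  obtain ⟨R, hR⟩ := H.slim hK
  refine ⟨R, fun x y z p q r hp hq hr u hu => ?_⟩
  obtain ⟨i, rfl, hi⟩ := Walk.mem_support_iff_exists_getVert.1 hu
  have hq' : q.reverse.length = G.dist z y := by rw [Walk.length_reverse, hq, dist_comm]
  rcases hR p.getVert q.reverse.getVert r.getVert _ _ _ (p.isGeodesicSeq_getVert hG hp)
    (q.reverse.isGeodesicSeq_getVert hG hq') (r.isGeodesicSeq_getVert hG hr) (by simp)
    (by rw [Walk.getVert_length, Walk.getVert_length]) (by simp) i hi with
    ⟨j, hj, hij⟩ | ⟨j, hj, hij⟩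
  · exact ⟨_, .inl (by simpa using q.reverse.getVert_mem_support j), by exact_mod_cast hij⟩
  · exact ⟨_, .inr (r.getVert_mem_support j), by exact_mod_cast hij⟩

end SimpleGraph

/-! ### The two distances on the group of units -/

namespace Units

open Digraph

variable {M : Type*} [Monoid M] {S : Set M}

/-- The directed distance between units in the right Cayley graph of the ambient monoid. -/
noncomputable def directedDist (S : Set M) (x y : Mˣ) : ℕ :=
  ((rightCayley S).edist (x : M) (y : M)).toNat

theorem edist_ne_top (hS : Submonoid.closure S = ⊤) (x y : Mˣ) :
    (rightCayley S).edist (x : M) (y : M) ≠ ⊤ := by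
  have := rightCayley_edist_ne_top hS (x : M) ((x⁻¹ * y : Mˣ) : M)
  rwa [← Units.val_mul, _root_.mul_inv_cancel_left] at this

theorem coe_directedDist (hS : Submonoid.closure S = ⊤) (x y : Mˣ) :
    (directedDist S x y : ℕ∞) = (rightCayley S).edist (x : M) (y : M) :=
  ENat.natCast_toNat (edist_ne_top hS x y)

theorem directedDist_triangle (hS : Submonoid.closure S = ⊤) (x y z : Mˣ) :
    directedDist S x z ≤ directedDist S x y + directedDist S y z := by
  have := (rightCayley S).edist_triangle (x : M) y z
  simp only [← coe_directedDist hS] at this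
  exact_mod_cast this

theorem directedDist_mul_le (hS : Submonoid.closure S = ⊤) (g x y : Mˣ) :
    directedDist S (g * x) (g * y) ≤ directedDist S x y := by
  have := rightCayley_edist_mul_le (S := S) (g : M) x y
  simp only [← Units.val_mul, ← coe_directedDist hS] at this
  exact_mod_cast this

/-- Each vertex of a directed path ending at `y` is a left factor of the unit `y`, hence a unit by
Dedekind-finiteness. -/
theorem exists_isGeodesicSeq [IsDedekindFiniteMonoid M] (hS : Submonoid.closure S = ⊤)
    (x y : Mˣ) : ∃ f, IsGeodesicSeq (directedDist S) f (directedDist S x y) ∧ f 0 = x ∧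
      f (directedDist S x y) = y := by
  obtain ⟨p, hx, hy, hp⟩ := exists_path_length_eq_edist _ (edist_ne_top hS x y)
  have hgeo : Path.IsGeodesic p := by rw [Path.IsGeodesic, hp, hx, hy]
  have hlen : p.length = directedDist S x y := by
    rw [← coe_directedDist hS] at hp
    exact_mod_cast hp
  have hunit : ∀ i, ∃ u : Mˣ, i ≤ p.length → (u : M) = Path.vertex p i := by
    intro i
    by_cases hi : i ≤ p.length
    · have h1 := hgeo.edist_vertex hi le_rfl
      obtain ⟨m, hm⟩ := exists_mul_eq_of_edist_ne_top (h1 ▸ ENat.natCast_ne_top _)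
      rw [Path.vertex_length, hy] at hm
      obtain ⟨u, hu⟩ := isUnit_of_mul_isUnit_left (hm ▸ y.isUnit)
      exact ⟨u, fun _ => hu⟩
    · exact ⟨1, fun h => absurd h hi⟩
  choose f hf using hunit
  rw [← hlen]
  refine ⟨f, fun i j hij hj => ?_, ?_, ?_⟩
  · have := hgeo.edist_vertex hij hj
    rw [← hf i (by lia), ← hf j hj, ← coe_directedDist hS] at this
    exact_mod_cast this
  · exact Units.ext (by rw [hf 0 (by lia), Path.vertex_zero, hx])
  · exact Units.ext (by rw [hf _ le_rfl, Path.vertex_length, hy])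

theorem exists_path_of_isGeodesicSeq (hS : Submonoid.closure S = ⊤) {f : ℕ → Mˣ} {n : ℕ}
    (hf : IsGeodesicSeq (directedDist S) f n) :
    ∃ p : (rightCayley S).Path, Path.IsGeodesic p ∧ p.head = f 0 ∧ p.last = f n ∧
      Path.support p = (fun i => (f i : M)) '' Set.Iic n := by
  refine exists_path_of_edist_eq (fun i => (f i : M)) n fun i j hij hj => ?_
  rw [← coe_directedDist hS, hf i j hij hj]

theorem adj_mulCayley_of_edist_eq_one {x y : Mˣ} (h : (rightCayley S).edist (x : M) (y : M) = 1) :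
    x = y ∨ (SimpleGraph.mulCayley (Units.val ⁻¹' S : Set Mˣ)).Adj x y := by
  obtain ⟨s, hs, hxy⟩ := adj_of_edist_eq_one h
  refine or_iff_not_imp_left.2 fun hne => ?_
  have hval : ((x⁻¹ * y : Mˣ) : M) = s := by
    rw [Units.val_mul, ← hxy, Units.inv_mul_cancel_left]
  exact (SimpleGraph.mulCayley_adj' _ _ _).2 ⟨hne, x⁻¹ * y, by
    rwa [Set.mem_preimage, hval], .inl (_root_.mul_inv_cancel_left x y)⟩

theorem exists_walk_length_le_directedDist [IsDedekindFiniteMonoid M]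
    (hS : Submonoid.closure S = ⊤) (x y : Mˣ) :
    ∃ w : (SimpleGraph.mulCayley (Units.val ⁻¹' S : Set Mˣ)).Walk x y,
      w.length ≤ directedDist S x y := by
  obtain ⟨f, hf, h0, h1⟩ := exists_isGeodesicSeq hS x y
  have := SimpleGraph.exists_walk_length_le (G := SimpleGraph.mulCayley (Units.val ⁻¹' S : Set Mˣ))
    f (directedDist S x y) fun i hi => adj_mulCayley_of_edist_eq_one (by
      rw [← coe_directedDist hS, hf i (i + 1) (by lia) (by lia)]; simp)
  rwa [h0, h1] at this

theorem closure_preimage_val [IsDedekindFiniteMonoid M] (hS : Submonoid.closure S = ⊤) :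
    Subgroup.closure (Units.val ⁻¹' S : Set Mˣ) = ⊤ := by
  refine eq_top_iff.2 fun u _ => ?_
  have hu : (u : M) ∈ Submonoid.closure S := hS ▸ Submonoid.mem_top _
  generalize hm : (u : M) = m at hu
  induction hu using Submonoid.closure_induction generalizing u with
  | mem s hs => exact Subgroup.subset_closure (by rwa [Set.mem_preimage, hm])
  | one =>
    rw [Units.val_eq_one.1 hm]
    exact one_mem _
  | mul a b _ _ ha hb =>
    have hab : IsUnit (a * b) := hm ▸ u.isUnit
    obtain ⟨v, rfl⟩ := isUnit_of_mul_isUnit_left hab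
    obtain ⟨w, rfl⟩ := isUnit_of_mul_isUnit_right hab
    rw [← Units.val_mul] at hm
    rw [Units.ext hm]
    exact mul_mem (ha v trivial rfl) (hb w trivial rfl)

/-- Following a generator `a` costs at most 1; going back costs at most the directed distance from
`1` to `a⁻¹`, by left translation, and there are finitely many `a`. -/
theorem exists_directedDist_le_mul_dist [IsDedekindFiniteMonoid M]
    (hfin : S.Finite) (hS : Submonoid.closure S = ⊤) :
    ∃ K, 0 < K ∧ ∀ x y : Mˣ, directedDist S x y ≤
      K * (SimpleGraph.mulCayley (Units.val ⁻¹' S : Set Mˣ)).dist x y := by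
  have hA : (Units.val ⁻¹' S : Set Mˣ).Finite := hfin.preimage Units.val_injective.injOn
  obtain ⟨B, hB⟩ := (hA.image fun a => directedDist S 1 a⁻¹).bddAbove
  have hadj : ∀ x y : Mˣ, (SimpleGraph.mulCayley (Units.val ⁻¹' S : Set Mˣ)).Adj x y →
      directedDist S x y ≤ B + 1 := by
    intro x y hxy
    obtain ⟨-, a, ha, rfl | rfl⟩ := (SimpleGraph.mulCayley_adj' _ _ _).1 hxy
    · have h : (directedDist S x (x * a) : ℕ∞) ≤ 1 := by
        rw [coe_directedDist hS]
        exact edist_le_one (X := rightCayley S) ⟨a, ha, rfl⟩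
      have : directedDist S x (x * a) ≤ 1 := by exact_mod_cast h
      lia
    · have h1 := directedDist_mul_le hS (y * a) 1 a⁻¹
      have h2 := hB ⟨a, ha, rfl⟩
      rw [mul_one, _root_.mul_inv_cancel_right] at h1
      dsimp only at h2
      lia
  refine ⟨B + 1, by lia, fun x y => ?_⟩
  obtain ⟨w₀, -⟩ := exists_walk_length_le_directedDist hS x y
  obtain ⟨w, hw⟩ := w₀.reachable.exists_walk_length_eq_dist
  rw [← hw]
  clear hw w₀
  induction w with
  | nil => simp [directedDist]
  | @cons u v y h w ih =>
    have h1 := directedDist_triangle hS u v y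
    have h2 := hadj u v h
    rw [SimpleGraph.Walk.length_cons, mul_add]
    lia

end Units

/-! ### Conclusion -/

theorem mainTheorem10 (M : Type*) [Monoid M] [IsCancelMul M]
    (hM : IsStronglyHyperbolicMonoid M) : IsHyperbolicGroup Mˣ := by
  obtain ⟨S, hfin, hS, δ, hδ⟩ := hM
  obtain ⟨K, hK, hle⟩ := Units.exists_directedDist_le_mul_dist hfin hS
  have hconn : (SimpleGraph.mulCayley (Units.val ⁻¹' S : Set Mˣ)).Connected :=
    { preconnected := fun x y => (Units.exists_walk_length_le_directedDist hS x y).choose.reachable }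
  have hdist (x y : Mˣ) : (SimpleGraph.mulCayley (Units.val ⁻¹' S : Set Mˣ)).dist x y ≤
      Units.directedDist S x y := by
    obtain ⟨w, hw⟩ := Units.exists_walk_length_le_directedDist hS x y
    exact (SimpleGraph.dist_le w).trans hw
  have hclose (x y : Mˣ)
      (h : ((Digraph.rightCayley S).edist (x : M) (y : M) : ℝ≥0∞) ≤ δ) :
      (SimpleGraph.mulCayley (Units.val ⁻¹' S : Set Mˣ)).dist x y ≤ ⌈δ⌉₊ := by
    refine (hdist x y).trans ?_
    rw [← Units.coe_directedDist hS] at h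
    have h' : ((Units.directedDist S x y : ℕ) : ℝ≥0) ≤ δ := by
      rw [← ENNReal.coe_le_coe]
      simpa using h
    exact_mod_cast h'.trans (Nat.le_ceil δ)
  refine ⟨Units.val ⁻¹' S, hfin.preimage Units.val_injective.injOn, Units.closure_preimage_val hS,
    SimpleGraph.isSlimHyperbolic_of_isThinPair hconn (d := Units.directedDist S) (h := ⌈δ⌉₊) hK
    { self := fun x => SimpleGraph.dist_self
      comm := fun x y => SimpleGraph.dist_comm
      triangle := fun x y z => hconn.dist_triangle
      le := hdist
      le_mul := hle
      exists_geodesic := Units.exists_isGeodesicSeq hS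
      thin := fun f g k n m l hf hg hk hfg hfk hgk i hi => ?_ }⟩
  obtain ⟨p, hp, hp0, hp1, hps⟩ := Units.exists_path_of_isGeodesicSeq hS hf
  obtain ⟨q, hq, hq0, hq1, hqs⟩ := Units.exists_path_of_isGeodesicSeq hS hg
  obtain ⟨r, hr, hr0, hr1, hrs⟩ := Units.exists_path_of_isGeodesicSeq hS hk
  -- Thinness of the base suffices, since any side of a triangle of units can be made the base.
  have hthin := (hδ p q r ⟨hp, hq, hr, by rw [hp1, hq0, hfg], by rw [hp0, hr0, hfk],
    by rw [hq1, hr1, hgk]⟩).1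
  rw [hps, hqs, hrs] at hthin
  rcases hthin ⟨i, hi, rfl⟩ with h | h
  · simp only [Digraph.outNhd, Set.mem_iUnion] at h
    obtain ⟨_, ⟨j, hj, rfl⟩, hji⟩ := h
    exact .inl ⟨j, hj, SimpleGraph.dist_comm.trans_le (hclose _ _ hji)⟩
  · simp only [Digraph.inNhd, Set.mem_iUnion] at h
    obtain ⟨_, ⟨j, hj, rfl⟩, hij⟩ := h
    exact .inr ⟨j, hj, hclose _ _ hij⟩
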